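/- Let $\mathbb P=\omega^\omega$ carry the product topology, where $\omega$ is discrete. A space $Y$ is $\mathbb P$-dominated if there is a cover $\{C_K : K\subseteq\mathbb P \text{ compact}\}$ of $Y$ by compact subsets such that $K\subseteq L$ implies $C_K\subseteq C_L$. A space $X$ has a $\mathbb P$-diagonal if the complement of the diagonal $\{(x,x):x\in X\}$ in $X\times X$ (with the subspace topology) is $\mathbb P$-dominated. Theorem. Let $X$ be a compact Hausdorff space. (1) If there is a continuous map from $X$ onto the Cantor cube $2^{\omega_1}$, then $X$ does not have a $\mathbb P$-diagonal. (2) If $X$ has a $\mathbb P$-diagonal, then there is no continuous map from $X$ onto the Tychonoff cube $[0,1]^{\omega_1}$. -/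

import Mathlib

open scoped unitInterval

/-- A space `Y` is `M`-dominated if there is a cover `{C K : K a compact subset of M}` of `Y`
by compact subsets such that `K ⊆ L` implies `C K ⊆ C L`. -/
def IsDominatedBy (M Y : Type*) [TopologicalSpace M] [TopologicalSpace Y] : Prop :=
  ∃ C : TopologicalSpace.Compacts M → Set Y,
    (∀ K, IsCompact (C K)) ∧
    (⋃ K, C K) = Set.univ ∧
    ∀ K L : TopologicalSpace.Compacts M, (K : Set M) ⊆ (L : Set M) → C K ⊆ C L

/-- The space `ℙ = ω^ω` (homeomorphic to the irrationals): the product of countably many copies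
of the discrete space of natural numbers. -/
abbrev SpaceP : Type := ℕ → ℕ

/-- A space `X` has a `ℙ`-diagonal if the complement of the diagonal in `X × X`, with the subspace
topology, is `ℙ`-dominated. -/
def HasPDiagonal (X : Type*) [TopologicalSpace X] : Prop :=
  IsDominatedBy SpaceP {p : X × X // p ∉ Set.diagonal X}

/-- The set of countable ordinals, the first uncountable ordinal as a set. -/
abbrev OmegaOne : Type 1 := Set.Iio (Ordinal.omega.{0} 1)

/-- The Cantor cube `2^{ω₁}` with the product topology. -/
abbrev CantorCube : Type 1 := OmegaOne → Bool

/-- The Tychonoff cube `[0,1]^{ω₁}` with the product topology. -/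
abbrev TychonoffCube : Type 1 := OmegaOne → I

open Set Topology

/-! The compact sets `Iic g` are cofinal among compact subsets of ω^ω, so a ℙ-diagonal yields
compact sets `C g`, monotone in `g`, whose union is the complement of the diagonal. A closed set is
big if it still maps onto a cube after countably many coordinates are dropped; decreasing sequences
of big sets have big intersections. Key lemma (`exists_isBig`): if a monotone family of closed sets
indexed by ω^ω has union mapping onto a cube off countably many coordinates, some member is big. The
proof splits on whether ω^ω has a dominating family indexed by ω₁. Applied to sections of the `C g`,
this produces points x₀, x₁, ... with (xₙ, xₖ) in `C (gₙ)` for n < k, where gₙ agrees with a fixed g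
below n. The gₙ have a common bound h, so all these pairs lie in `C h`; a cluster point p puts (p,
p) in this closed set, a contradiction. The Tychonoff cube reduces to the Cantor cube, which it
contains as a closed subspace. -/

/-! ### Fusion along a branch of ω^ω -/

theorem exists_branch {S : Type*} (P : ℕ → (ℕ → ℕ) → S → Prop) (R : S → S → Prop)
    (hcongr : ∀ n s s' t, (∀ i < n, s i = s' i) → P n s t → P n s' t)
    {s₀ : ℕ → ℕ} {t₀ : S} (h₀ : P 0 s₀ t₀)
    (hstep : ∀ n s t, P n s t → ∃ m t', R t t' ∧ P (n + 1) (Function.update s n m) t') :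
    ∃ (g : ℕ → ℕ) (τ : ℕ → S), ∀ n, R (τ n) (τ (n + 1)) ∧ P n g (τ n) := by
  classical
  choose! m t' hR hP using hstep
  let st : ℕ → (ℕ → ℕ) × S := fun n => Nat.rec (s₀, t₀)
    (fun n p => (Function.update p.1 n (m n p.1 p.2), t' n p.1 p.2)) n
  have hst : ∀ n, st (n + 1) = (Function.update (st n).1 n (m n (st n).1 (st n).2),
    t' n (st n).1 (st n).2) := fun n => rfl
  have hPn : ∀ n, P n (st n).1 (st n).2 := by
    intro n
    induction n with
    | zero => exact h₀
    | succ n ih => rw [hst]; exact hP _ _ _ ih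
  have hagree : ∀ n k, ∀ i < n, (st (n + k)).1 i = (st n).1 i := by
    intro n k i hi
    induction k with
    | zero => rfl
    | succ k ih =>
      rw [← add_assoc, hst]
      simp only
      rw [Function.update_of_ne (by omega), ih]
  refine ⟨fun n => (st (n + 1)).1 n, fun n => (st n).2, fun n => ⟨?_, ?_⟩⟩
  · simp only [hst]; exact hR _ _ _ (hPn n)
  · refine hcongr n _ _ _ (fun i hi => ?_) (hPn n)
    obtain ⟨k, rfl⟩ := Nat.exists_eq_add_of_le (Nat.succ_le_of_lt hi)
    exact hagree (i + 1) k i (by omega)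

/-- At coordinate m only the finitely many functions with n ≤ m can differ from `g`. -/
theorem exists_bound_of_agree (g h : ℕ → ℕ) (G : ℕ → ℕ → ℕ → ℕ)
    (hG : ∀ n i, ∀ m < n, G n i m = g m) : ∃ g', ∀ n, ∀ i ≤ h n, G n i ≤ g' := by
  refine ⟨fun m => g m + ∑ n ∈ Finset.range (m + 1), ∑ i ∈ Finset.range (h n + 1), G n i m,
    fun n i hi m => ?_⟩
  rcases lt_or_ge m n with hmn | hmn
  · rw [hG n i m hmn]; exact Nat.le_add_right _ _
  · refine le_trans ?_ (Nat.le_add_left _ _)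
    exact (Finset.single_le_sum (f := fun i => G n i m) (fun _ _ => Nat.zero_le _)
      (Finset.mem_range.2 (Nat.lt_succ_of_le hi))).trans
      (Finset.single_le_sum (f := fun n => ∑ i ∈ Finset.range (h n + 1), G n i m)
      (fun _ _ => Nat.zero_le _) (Finset.mem_range.2 (Nat.lt_succ_of_le hmn)))

/-- Separability of 2^ι for |ι| ≤ 2^ω: a finite set of nodes of 2^{<ω} codes the point that is true
at ξ when the branch `r ξ` meets it. -/
theorem exists_seq_dense_of_injective {ι : Type*} {r : ι → ℕ → Bool}
    (hr : Function.Injective r) :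
    ∃ d : ℕ → ι → Bool, ∀ F : Finset ι, ∀ y : ι → Bool, ∃ k, ∀ ξ ∈ F, d k ξ = y ξ := by
  classical
  let d' : Finset (List Bool) → ι → Bool :=
    fun s ξ => decide (∃ k, (List.range k).map (r ξ) ∈ s)
  obtain ⟨e, he⟩ := exists_surjective_nat (Finset (List Bool))
  refine ⟨fun k => d' (e k), fun F y => ?_⟩
  have hk : ∃ k, ∀ ξ ∈ F, ∀ η ∈ F, (∀ i < k, r ξ i = r η i) → ξ = η := by
    have : ∀ p : ι × ι, ∃ k, (∀ i < k, r p.1 i = r p.2 i) → p.1 = p.2 := by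
      intro p
      by_cases hp : p.1 = p.2
      · exact ⟨0, fun _ => hp⟩
      · obtain ⟨i, hi⟩ := Function.ne_iff.1 (hr.ne hp)
        exact ⟨i + 1, fun h => (hi (h i (by omega))).elim⟩
    choose k hk using this
    refine ⟨(F ×ˢ F).sup k, fun ξ hξ η hη h => hk (ξ, η) fun i hi => h i ?_⟩
    exact hi.trans_le (Finset.le_sup (f := k) (Finset.mem_product.2 ⟨hξ, hη⟩))
  obtain ⟨k, hk⟩ := hk
  obtain ⟨j, hj⟩ := he ((F.filter fun ξ => y ξ = true).image fun ξ => (List.range k).map (r ξ))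
  refine ⟨j, fun ξ hξ => ?_⟩
  simp only [hj, d']
  rw [Bool.eq_iff_iff, decide_eq_true_iff]
  simp only [Finset.mem_image, Finset.mem_filter]
  constructor
  · rintro ⟨k', η, ⟨hη, hy⟩, heq⟩
    have hlen : k = k' := by simpa using congrArg List.length heq
    subst hlen
    have : ξ = η := hk ξ hξ η hη fun i hi => by
      have := (List.map_inj_left.1 heq) i (List.mem_range.2 hi)
      exact this.symm
    rwa [this]
  · exact fun hy => ⟨k, ξ, ⟨hξ, hy⟩, rfl⟩

/-! ### Category: dense sequences from nonmeagre sets -/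

/-- The sections of `A` are nonmeagre for uncountably many first coordinates. -/
def NonmeagreUncountably {ι : Type*} (A : Set (ι × (ℕ → ℕ))) : Prop :=
  ¬ {α | ¬ IsMeagre {c | (α, c) ∈ A}}.Countable

theorem nonmeagreUncountably_univ (ι : Type*) [Uncountable ι] :
    NonmeagreUncountably (univ : Set (ι × (ℕ → ℕ))) := by
  have : ¬ IsMeagre (univ : Set (ℕ → ℕ)) := not_isMeagre_of_isOpen isOpen_univ univ_nonempty
  simpa [NonmeagreUncountably, this] using not_countable_univ

theorem NonmeagreUncountably.exists_of_subset_iUnion {ι : Type*} {A : Set (ι × (ℕ → ℕ))}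
    (hA : NonmeagreUncountably A) {B : ℕ → Set (ι × (ℕ → ℕ))} (hB : A ⊆ ⋃ n, B n) :
    ∃ n, NonmeagreUncountably (B n) := by
  by_contra! h
  simp only [NonmeagreUncountably, not_not] at h
  refine hA ((countable_iUnion h).mono fun α hα => ?_)
  by_contra hn
  simp only [mem_iUnion, mem_ofPred_eq, not_exists, not_not] at hn
  refine hα ((isMeagre_iUnion hn).mono fun c hc => ?_)
  simpa using hB hc

theorem exists_cylinder_subset_closure {A : Set (ℕ → ℕ)} (hA : ¬ IsMeagre A) :
    ∃ l : List ℕ, ∀ c : ℕ → ℕ, (∀ i < l.length, c i = l.getD i 0) → c ∈ closure A := by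
  have h1 : ¬ IsNowhereDense A := fun h => hA h.isMeagre
  obtain ⟨w, hw⟩ := nonempty_iff_ne_empty.2 h1
  have hn := mem_interior_iff_mem_nhds.1 hw
  rw [nhds_pi, Filter.mem_pi] at hn
  obtain ⟨J, hI, t, ht, hsub⟩ := hn
  obtain ⟨n, hn⟩ := hI.bddAbove
  refine ⟨(List.range (n + 1)).map w, fun c hc => hsub fun i hi => ?_⟩
  have hin : i < n + 1 := Nat.lt_succ_of_le (hn hi)
  have := hc i (by simpa using hin)
  rw [this]
  simp [List.getD, hin]
  exact mem_of_mem_nhds (ht i)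

theorem NonmeagreUncountably.exists_seq {ι : Type*} [LinearOrder ι]
    (hι : ∀ α : ι, (Iic α).Countable) {e : ι → ι → ℕ} (he : ∀ ξ, InjOn (e ξ) (Iio ξ))
    {d : ℕ → ι → Bool} (hd : ∀ F : Finset ι, ∀ y : ι → Bool, ∃ k, ∀ ξ ∈ F, d k ξ = y ξ)
    {A : Set (ι × (ℕ → ℕ))} (hA : NonmeagreUncountably A) :
    ∃ (D : Set ι) (a : ℕ → ι × (ℕ → ℕ)), D.Countable ∧ (∀ i, a i ∈ A) ∧
      ∀ F : Finset ι, ∀ y : ι → Bool, ∃ i, ∀ ξ ∈ F, ξ ∉ D →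
        d ((a i).2 (e ξ (a i).1)) ξ = y ξ := by
  classical
  have h1 : ∀ α, ∃ l : List ℕ, ¬ IsMeagre {c | (α, c) ∈ A} → ∀ c : ℕ → ℕ,
      (∀ i < l.length, c i = l.getD i 0) → c ∈ closure {c | (α, c) ∈ A} := by
    intro α
    by_cases h : IsMeagre {c | (α, c) ∈ A}
    · exact ⟨[], fun h' => (h' h).elim⟩
    · obtain ⟨l, hl⟩ := exists_cylinder_subset_closure h
      exact ⟨l, fun _ => hl⟩
  choose L hL using h1
  obtain ⟨l, hl⟩ : ∃ l, {α | ¬ IsMeagre {c | (α, c) ∈ A} ∧ L α = l}.Infinite := by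
    by_contra! h
    refine hA ((countable_iUnion fun l => (h l).countable).mono fun α hα => ?_)
    exact mem_iUnion.2 ⟨L α, hα, rfl⟩
  let b := hl.natEmbedding
  -- The stem `l`, shared by infinitely many sections, is continued by the constant `k`. For most
  -- `j` the position `e ξ (b j)` lies past the stem, so the value read there is `k`.
  let c₀ : ℕ → ℕ → ℕ := fun k i => if i < l.length then l.getD i 0 else k
  have hc : ∀ p : ℕ × ℕ × ℕ, ∃ c, ((b p.1 : ι), c) ∈ A ∧ ∀ i < p.2.1, c i = c₀ p.2.2 i := by
    rintro ⟨j, m, k⟩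
    have hmem : c₀ k ∈ closure {c | ((b j : ι), c) ∈ A} := by
      refine hL _ (b j).2.1 _ fun i hi => ?_
      rw [(b j).2.2] at hi ⊢
      simp [c₀, hi]
    have hopen : IsOpen {c : ℕ → ℕ | ∀ i ∈ Finset.range m, c i = c₀ k i} := by
      have := isOpen_biInter_finset (s := Finset.range m) fun i _ =>
        (isOpen_discrete ({c₀ k i} : Set ℕ)).preimage (continuous_apply (A := fun _ => ℕ) i)
      convert this using 1
      ext c
      simp
    obtain ⟨c, hc1, hc2⟩ := mem_closure_iff.1 hmem _ hopen (fun _ _ => rfl)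
    exact ⟨c, hc2, fun i hi => hc1 i (Finset.mem_range.2 hi)⟩
  choose c hcA hc using hc
  obtain ⟨u, hu⟩ := exists_surjective_nat (ℕ × ℕ × ℕ)
  refine ⟨⋃ j, Iic (b j : ι), fun i => (b (u i).1, c (u i)), countable_iUnion fun j => hι _,
    fun i => hcA _, fun F y => ?_⟩
  obtain ⟨k, hk⟩ := hd F y
  let F' := F.filter fun ξ => ξ ∉ ⋃ j, Iic (b j : ι)
  have hF' : ∀ ξ ∈ F', ∀ j, (b j : ι) < ξ := by
    intro ξ hξ j
    have := (Finset.mem_filter.1 hξ).2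
    simp only [mem_iUnion, mem_Iic, not_exists, not_le] at this
    exact this j
  have hfin : (⋃ ξ ∈ F', {j | e ξ (b j) < l.length}).Finite := by
    refine F'.finite_toSet.biUnion fun ξ hξ => ?_
    refine Finite.of_finite_image (f := fun j => e ξ (b j))
      ((finite_lt_nat l.length).subset ?_) ?_
    · rintro _ ⟨j, hj, rfl⟩; exact hj
    · intro i _ j _ hij
      exact b.injective (Subtype.ext (he ξ (hF' ξ hξ i) (hF' ξ hξ j) hij))
  obtain ⟨j, hj⟩ := hfin.exists_notMem
  simp only [mem_iUnion, mem_ofPred_eq, exists_prop, not_exists, not_and, not_lt] at hj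
  obtain ⟨i, hi⟩ := hu (j, F'.sup (fun ξ => e ξ (b j)) + 1, k)
  refine ⟨i, fun ξ hξ hξD => ?_⟩
  have hξ' : ξ ∈ F' := Finset.mem_filter.2 ⟨hξ, hξD⟩
  simp only [hi]
  rw [hc _ _ (Nat.lt_succ_of_le (Finset.le_sup (f := fun ξ => e ξ (b j)) hξ'))]
  simp only [c₀, if_neg (not_lt.2 (hj ξ hξ'))]
  exact hk ξ hξ

/-! ### Big closed sets and the key lemma -/

/-- A closed set `Z` is big for `φ : X → 2^ι` if its image projects onto a cube `2^(ι \ D)`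
with `D` countable. -/
def IsBig {X ι : Type*} [TopologicalSpace X] (φ : X → ι → Bool) (Z : Set X) : Prop :=
  IsClosed Z ∧ ∃ D : Set ι, D.Countable ∧ ∀ y : ι → Bool, ∃ z ∈ Z, ∀ ξ ∉ D, φ z ξ = y ξ

section Big

variable {X ι : Type*} [TopologicalSpace X] {φ : X → ι → Bool}

theorem isClosed_setOf_apply_eq (hφ : Continuous φ) (ξ : ι) (b : Bool) :
    IsClosed {z | φ z ξ = b} :=
  isClosed_eq ((continuous_apply ξ).comp hφ) continuous_const

theorem isClosed_setOf_eq_off (hφ : Continuous φ) (D : Set ι) (y : ι → Bool) :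
    IsClosed {z | ∀ ξ ∉ D, φ z ξ = y ξ} := by
  have := isClosed_iInter fun ξ => isClosed_iInter fun _ : ξ ∉ D =>
    isClosed_setOf_apply_eq hφ ξ (y ξ)
  convert this using 1
  ext z
  simp

theorem exists_eq_off_of_forall_finset [CompactSpace X] (hφ : Continuous φ) {Z : Set X}
    (hZ : IsClosed Z) (D : Set ι) (y : ι → Bool)
    (h : ∀ F : Finset ι, ∃ z ∈ Z, ∀ ξ ∈ F, ξ ∉ D → φ z ξ = y ξ) :
    ∃ z ∈ Z, ∀ ξ ∉ D, φ z ξ = y ξ := by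
  have hcl : ∀ ξ : {ξ // ξ ∉ D}, IsClosed {z | φ z ξ = y ξ} := fun ξ =>
    isClosed_setOf_apply_eq hφ _ _
  obtain ⟨z, hz, hz'⟩ := hZ.isCompact.inter_iInter_nonempty _ hcl fun u => by
    classical
    obtain ⟨z, hz, h'⟩ := h (u.image Subtype.val)
    refine ⟨z, hz, mem_iInter₂.2 fun ξ hξ => h' ξ (Finset.mem_image_of_mem _ hξ) ξ.2⟩
  exact ⟨z, hz, fun ξ hξ => mem_iInter.1 hz' ⟨ξ, hξ⟩⟩

theorem IsBig.iInter [CompactSpace X] (hφ : Continuous φ) {Z : ℕ → Set X}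
    (hZ : ∀ n, IsBig φ (Z n)) (hanti : ∀ n, Z (n + 1) ⊆ Z n) : IsBig φ (⋂ n, Z n) := by
  choose hcl D hD hy using hZ
  refine ⟨isClosed_iInter hcl, ⋃ n, D n, countable_iUnion hD, fun y => ?_⟩
  have hne := IsCompact.nonempty_iInter_of_sequence_nonempty_isCompact_isClosed
    (fun n => Z n ∩ {z | ∀ ξ ∉ ⋃ n, D n, φ z ξ = y ξ})
    (fun n => inter_subset_inter_left _ (hanti n))
    (fun n => by
      obtain ⟨z, hz, h⟩ := hy n y
      exact ⟨z, hz, fun ξ hξ => h ξ fun hn => hξ (mem_iUnion.2 ⟨n, hn⟩)⟩)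
    (((hcl 0).inter (isClosed_setOf_eq_off hφ _ y)).isCompact)
    (fun n => (hcl n).inter (isClosed_setOf_eq_off hφ _ y))
  obtain ⟨z, hz⟩ := hne
  rw [mem_iInter] at hz
  exact ⟨z, mem_iInter.2 fun n => (hz n).1, (hz 0).2⟩

theorem exists_isBig_of_dominating [LinearOrder ι] [WellFoundedLT ι]
    (hι : ∀ α : ι, (Iic α).Countable) [CompactSpace X] (hφ : Continuous φ)
    {H : (ℕ → ℕ) → Set X} (hcl : ∀ g, IsClosed (H g)) (hmono : Monotone H)
    {D : Set ι} (hD : D.Countable) (hcov : ∀ y : ι → Bool, ∃ g, ∃ z ∈ H g, ∀ ξ ∉ D, φ z ξ = y ξ)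
    {f : ι → ℕ → ℕ} (hf : ∀ g, ∃ α, g ≤ f α) : ∃ g, IsBig φ (H g) := by
  classical
  by_contra! hno
  have h1 : ∀ (α : ι) (E : Set ι), ∃ (F : Finset ι) (y : ι → Bool), E.Countable →
      ∀ z ∈ H (f α), ∃ ξ ∈ F, ξ ∉ E ∧ φ z ξ ≠ y ξ := by
    intro α E
    by_cases hE : E.Countable
    · by_contra! h
      refine hno (f α) ⟨hcl _, E, hE, fun y =>
        exists_eq_off_of_forall_finset hφ (hcl _) E y fun F => ?_⟩
      exact (h F y).2
    · exact ⟨∅, fun _ => false, fun h => (hE h).elim⟩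
  choose G Y hG using h1
  -- Each `H (f α)` omits a finite pattern off any countable set; recursion makes the patterns live
  -- on disjoint coordinates, so one point can realise all of them.
  let S : ι → Finset ι := WellFounded.fix (wellFounded_lt (α := ι))
    fun α ih => G α (D ∪ ⋃ (β) (h : β < α), (ih β h : Set ι))
  let E : ι → Set ι := fun α => D ∪ ⋃ (β) (_ : β < α), (S β : Set ι)
  have hS : ∀ α, S α = G α (E α) := fun α => WellFounded.fix_eq _ _ α
  have hE : ∀ α, (E α).Countable := fun α =>
    hD.union (((hι α).mono Iio_subset_Iic_self).biUnion fun β _ => (S β).countable_toSet)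
  have huniq : ∀ α β ξ, ξ ∈ S α → ξ ∉ E α → ξ ∈ S β → ξ ∉ E β → α = β := by
    intro α β ξ h1 h2 h3 h4
    rcases lt_trichotomy α β with h | h | h
    · exact (h4 (Or.inr (mem_iUnion₂.2 ⟨α, h, h1⟩))).elim
    · exact h
    · exact (h2 (Or.inr (mem_iUnion₂.2 ⟨β, h, h3⟩))).elim
  obtain ⟨g, z, hz, hzy⟩ := hcov fun ξ =>
    if h : ∃ α, ξ ∈ S α ∧ ξ ∉ E α then Y h.choose (E h.choose) ξ else false
  obtain ⟨α, hα⟩ := hf g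
  obtain ⟨ξ, hξ, hξE, hne⟩ := hG α (E α) (hE α) z (hmono hα hz)
  rw [← hS] at hξ
  have hex : ∃ α, ξ ∈ S α ∧ ξ ∉ E α := ⟨α, hξ, hξE⟩
  have heq : hex.choose = α :=
    huniq _ _ ξ hex.choose_spec.1 hex.choose_spec.2 hξ hξE
  have := hzy ξ fun h => hξE (Or.inl h)
  rw [dif_pos hex, heq] at this
  exact hne this

theorem exists_isBig_of_not_dominating [LinearOrder ι] [Uncountable ι]
    (hι : ∀ α : ι, (Iic α).Countable) {r : ι → ℕ → Bool} (hr : Function.Injective r)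
    [CompactSpace X] (hφ : Continuous φ)
    {H : (ℕ → ℕ) → Set X} (hcl : ∀ g, IsClosed (H g)) (hmono : Monotone H)
    {D : Set ι} (hD : D.Countable) (hcov : ∀ y : ι → Bool, ∃ g, ∃ z ∈ H g, ∀ ξ ∉ D, φ z ξ = y ξ)
    (hf : ∀ f : Finset ι × Finset ι → ℕ → ℕ, ∃ h : ℕ → ℕ, ∀ p, ∃ n, f p n ≤ h n) :
    ∃ g, IsBig φ (H g) := by
  classical
  obtain ⟨d, hd⟩ := exists_seq_dense_of_injective hr
  have he : ∀ ξ : ι, ∃ e : ι → ℕ, InjOn e (Iio ξ) := fun ξ =>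
    countable_iff_exists_injOn.1 ((hι ξ).mono Iio_subset_Iic_self)
  choose e he using he
  have hzg : ∀ p : ι × (ℕ → ℕ), ∃ g, ∃ z ∈ H g, ∀ ξ ∉ D, φ z ξ = d (p.2 (e ξ p.1)) ξ :=
    fun p => hcov fun ξ => d (p.2 (e ξ p.1)) ξ
  choose g z hz hzq using hzg
  obtain ⟨g₀, -, hg₀⟩ := exists_branch (S := Unit)
    -- Countably many choices of the next digit split the set, so one of them keeps it nonmeagre in
    -- uncountably many sections.
    (fun n s _ => NonmeagreUncountably {p | ∀ i < n, g p i = s i}) (fun _ _ => True)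
    (fun n s s' _ hs h => by
      have : {p : ι × (ℕ → ℕ) | ∀ i < n, g p i = s' i} = {p | ∀ i < n, g p i = s i} :=
        Set.ext fun p => forall₂_congr fun i hi => by rw [hs i hi]
      rwa [this])
    (s₀ := 0) (t₀ := ()) (by simpa using nonmeagreUncountably_univ ι)
    (fun n s _ h => by
      obtain ⟨m, hm⟩ := h.exists_of_subset_iUnion
        (B := fun m => {p | ∀ i < n + 1, g p i = Function.update s n m i}) (fun p hp => by
          refine mem_iUnion.2 ⟨g p n, fun i hi => ?_⟩
          rcases Nat.lt_succ_iff_lt_or_eq.1 hi with h | rfl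
          · rw [Function.update_of_ne h.ne]; exact hp i h
          · simp)
      exact ⟨m, (), trivial, hm⟩)
  choose E a hE ha hdense using fun n => (hg₀ n).2.exists_seq hι he hd
  have hdense' : ∀ (p : Finset ι × Finset ι) (n : ℕ), ∃ i, ∀ ξ ∈ p.1, ξ ∉ E n →
      d ((a n i).2 (e ξ (a n i).1)) ξ = decide (ξ ∈ p.2) := fun p n =>
    hdense n p.1 fun ξ => decide (ξ ∈ p.2)
  choose f hfp using hdense'
  -- `f p n` is an index at which the `n`-th sequence realises pattern `p`; `h` catches every
  -- pattern at some level, so one bound `g'` serves all of them.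
  obtain ⟨h, hh⟩ := hf f
  obtain ⟨g', hg'⟩ := exists_bound_of_agree g₀ h (fun n i => g (a n i)) fun n i => ha n i
  refine ⟨g', hcl _, D ∪ ⋃ n, E n, hD.union (countable_iUnion hE), fun y => ?_⟩
  refine exists_eq_off_of_forall_finset hφ (hcl _) _ y fun F => ?_
  obtain ⟨n, hn⟩ := hh (F, F.filter fun ξ => y ξ = true)
  refine ⟨_, hmono (hg' n _ hn) (hz _), fun ξ hξ hξD => ?_⟩
  rw [hzq _ _ fun h => hξD (Or.inl h),
    hfp (F, F.filter fun ξ => y ξ = true) n ξ hξ fun h => hξD (Or.inr (mem_iUnion.2 ⟨n, h⟩))]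
  simp [hξ]

theorem exists_isBig [LinearOrder ι] [WellFoundedLT ι] [Uncountable ι]
    (hι : ∀ α : ι, (Iic α).Countable) {r : ι → ℕ → Bool} (hr : Function.Injective r)
    [CompactSpace X] (hφ : Continuous φ)
    {H : (ℕ → ℕ) → Set X} (hcl : ∀ g, IsClosed (H g)) (hmono : Monotone H)
    {D : Set ι} (hD : D.Countable)
    (hcov : ∀ y : ι → Bool, ∃ g, ∃ z ∈ H g, ∀ ξ ∉ D, φ z ξ = y ξ) :
    ∃ g, IsBig φ (H g) := by
  have : Infinite ι := inferInstance
  obtain ⟨u⟩ : Nonempty (ι ≃ Finset ι × Finset ι) := by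
    refine Cardinal.eq.1 ?_
    rw [Cardinal.mk_prod, Cardinal.lift_id, Cardinal.mk_finset_of_infinite,
      Cardinal.mul_eq_self (Cardinal.aleph0_le_mk ι)]
  by_cases h : ∃ f : ι → ℕ → ℕ, ∀ g, ∃ α, g ≤ f α
  · obtain ⟨f, hf⟩ := h
    exact exists_isBig_of_dominating hι hφ hcl hmono hD hcov hf
  · refine exists_isBig_of_not_dominating hι hr hφ hcl hmono hD hcov fun f => ?_
    push Not at h
    obtain ⟨g, hg⟩ := h (f ∘ u)
    refine ⟨g, fun p => ?_⟩
    by_contra! hlt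
    refine hg (u.symm p) fun n => ?_
    simpa using (hlt n).le

theorem exists_isBig_inter_section [LinearOrder ι] [WellFoundedLT ι] [Uncountable ι]
    (hι : ∀ α : ι, (Iic α).Countable) {r : ι → ℕ → Bool} (hr : Function.Injective r)
    [CompactSpace X] (hφ : Continuous φ) {C : (ℕ → ℕ) → Set (X × X)}
    (hcl : ∀ g, IsClosed (C g)) (hmono : Monotone C) (hcov : ∀ x y, x ≠ y → ∃ g, (x, y) ∈ C g)
    {Z : Set X} (hZ : IsBig φ Z) (x : X) : ∃ g, IsBig φ (Z ∩ {y | (x, y) ∈ C g}) := by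
  classical
  obtain ⟨hZcl, D, hD, hy⟩ := hZ
  obtain ⟨ξ₀, hξ₀⟩ : ∃ ξ, ξ ∉ D := by
    by_contra! h
    exact not_countable_univ (hD.mono fun ξ _ => h ξ)
  refine exists_isBig hι hr hφ (H := fun g => Z ∩ {y | (x, y) ∈ C g})
    (fun g => hZcl.inter ((hcl g).preimage (Continuous.prodMk_right x)))
    (fun g g' h => inter_subset_inter_right _ fun y hy => hmono h hy)
    (hD.union (countable_singleton ξ₀)) fun y => ?_
  -- Flipping coordinate `ξ₀` of `φ x` keeps `z` off `x`, at the cost of dropping `ξ₀`.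
  obtain ⟨z, hz, hzy⟩ := hy (Function.update y ξ₀ (!(φ x ξ₀)))
  have hne : x ≠ z := by
    rintro rfl
    simpa using hzy ξ₀ hξ₀
  obtain ⟨g, hg⟩ := hcov x z hne
  refine ⟨g, z, ⟨hz, hg⟩, fun ξ hξ => ?_⟩
  rw [mem_union, not_or, mem_singleton_iff] at hξ
  rw [hzy ξ hξ.1, Function.update_of_ne hξ.2]

theorem false_of_monotone_closed_cover_compl_diagonal
    [LinearOrder ι] [WellFoundedLT ι] [Uncountable ι]
    (hι : ∀ α : ι, (Iic α).Countable) {r : ι → ℕ → Bool} (hr : Function.Injective r)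
    [CompactSpace X] (hφ : Continuous φ) (hsurj : Function.Surjective φ)
    {C : (ℕ → ℕ) → Set (X × X)} (hcl : ∀ g, IsClosed (C g)) (hmono : Monotone C)
    (hdiag : ∀ g x, (x, x) ∉ C g) (hcov : ∀ x y, x ≠ y → ∃ g, (x, y) ∈ C g) : False := by
  have huniv : IsBig φ univ := ⟨isClosed_univ, ∅, countable_empty, fun y => by
    obtain ⟨z, rfl⟩ := hsurj y
    exact ⟨z, trivial, fun _ _ => rfl⟩⟩
  -- Quantifying over all big `Z' ⊆ Z` makes the condition survive shrinking, hence usable inside `⋂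
  -- n, Z n` at every level.
  obtain ⟨g, Z, hgZ⟩ := exists_branch (S := Set X)
    (fun n s Z => IsBig φ Z ∧ ∀ Z' ⊆ Z, IsBig φ Z' → ∃ x ∈ Z', ∃ g, (∀ i < n, g i = s i) ∧
      IsBig φ (Z' ∩ {y | (x, y) ∈ C g}))
    (fun Z Z' => Z' ⊆ Z)
    (fun n s s' Z hs h => by
      refine ⟨h.1, fun Z' hZ' hb => ?_⟩
      obtain ⟨x, hx, g, hg, hb'⟩ := h.2 Z' hZ' hb
      exact ⟨x, hx, g, fun i hi => (hg i hi).trans (hs i hi), hb'⟩)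
    (s₀ := 0) (t₀ := univ)
    ⟨huniv, fun Z' _ hb => by
      obtain ⟨x, hx, -⟩ := hb.2.choose_spec.2 fun _ => false
      obtain ⟨g, hg⟩ := exists_isBig_inter_section hι hr hφ hcl hmono hcov hb x
      exact ⟨x, hx, g, by simp, hg⟩⟩
    (fun n s Z h => by
      by_contra hno
      have hstep : ∀ (n' : ℕ) (Z₁ : {Z₁ : Set X // IsBig φ Z₁ ∧ Z₁ ⊆ Z}),
          ∃ Z' : {Z₁ : Set X // IsBig φ Z₁ ∧ Z₁ ⊆ Z}, Z'.1 ⊆ Z₁.1 ∧ ∀ x ∈ Z'.1, ∀ g,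
            (∀ i < n + 1, g i = Function.update s n n' i) →
            ¬ IsBig φ (Z'.1 ∩ {y | (x, y) ∈ C g}) := by
        intro n' Z₁
        by_contra! hcon
        refine hno ⟨n', Z₁.1, Z₁.2.2, Z₁.2.1, fun Z' hZ' hb => ?_⟩
        exact hcon ⟨Z', hb, hZ'.trans Z₁.2.2⟩ hZ'
      choose T hT1 hT2 using hstep
      -- If every next digit fails, the witnesses are nested; their intersection is big, and the
      -- digit `g n` found there contradicts its own witness.
      let W : ℕ → {Z₁ : Set X // IsBig φ Z₁ ∧ Z₁ ⊆ Z} := fun k =>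
        Nat.rec ⟨Z, h.1, Subset.rfl⟩ (fun k V => T k V) k
      have hW : ∀ k, W (k + 1) = T k (W k) := fun k => rfl
      obtain ⟨x, hx, g, hg, hb⟩ := h.2 (⋂ k, (W k).1)
        ((iInter_subset _ 0).trans (W 0).2.2)
        (IsBig.iInter hφ (fun k => (W k).2.1) fun k => by rw [hW]; exact hT1 _ _)
      rw [mem_iInter] at hx
      refine hT2 (g n) (W (g n)) x (hx (g n + 1)) g (fun i hi => ?_) ?_
      · rcases Nat.lt_succ_iff_lt_or_eq.1 hi with h | rfl
        · rw [Function.update_of_ne h.ne]; exact hg i h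
        · simp
      · obtain ⟨-, D, hD, hy⟩ := hb
        refine ⟨(T (g n) (W (g n))).2.1.1.inter
          ((hcl g).preimage (Continuous.prodMk_right x)), D, hD, fun y => ?_⟩
        obtain ⟨z, hz, hzy⟩ := hy y
        exact ⟨z, ⟨mem_iInter.1 hz.1 (g n + 1), hz.2⟩, hzy⟩)
  have hZω : IsBig φ (⋂ n, Z n) := IsBig.iInter hφ (fun n => (hgZ n).2.1) fun n => (hgZ n).1
  have hnext : ∀ (n : ℕ) (V : {V : Set X // IsBig φ V ∧ V ⊆ ⋂ n, Z n}),
      ∃ x ∈ V.1, ∃ g', (∀ i < n, g' i = g i) ∧ IsBig φ (V.1 ∩ {y | (x, y) ∈ C g'}) :=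
    fun n V => (hgZ n).2.2 V.1 (V.2.2.trans (iInter_subset _ n)) V.2.1
  choose x hx G hG hbig using hnext
  let W : ℕ → {V : Set X // IsBig φ V ∧ V ⊆ ⋂ n, Z n} := fun k =>
    Nat.rec ⟨_, hZω, Subset.rfl⟩
      (fun k V => ⟨_, hbig k V, inter_subset_left.trans V.2.2⟩) k
  have hW : ∀ k, (W (k + 1)).1 = (W k).1 ∩ {y | (x k (W k), y) ∈ C (G k (W k))} := fun k => rfl
  have hanti : Antitone fun k => (W k).1 :=
    antitone_nat_of_succ_le fun k => by rw [hW]; exact inter_subset_left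
  obtain ⟨h, hh⟩ := exists_bound_of_agree g 0 (fun n _ => G n (W n)) fun n _ => hG n (W n)
  have hpair : ∀ n k, n < k → (x n (W n), x k (W k)) ∈ C h := by
    intro n k hnk
    have h1 : x k (W k) ∈ (W (n + 1)).1 := hanti (Nat.succ_le_of_lt hnk) (hx k (W k))
    rw [hW] at h1
    exact hmono (hh n 0 le_rfl) h1.2
  obtain ⟨p, hp⟩ := exists_clusterPt_of_compactSpace
    (Filter.map (fun n => x n (W n)) Filter.atTop)
  have hnhds : (C h)ᶜ ∈ 𝓝 (p, p) := (hcl h).isOpen_compl.mem_nhds (hdiag h p)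
  rw [nhds_prod_eq, Filter.mem_prod_same_iff] at hnhds
  obtain ⟨V, hV, hVC⟩ := hnhds
  have hfreq : ∃ᶠ n in Filter.atTop, x n (W n) ∈ V := (mapClusterPt_iff_frequently.1 hp) V hV
  rw [Filter.frequently_atTop] at hfreq
  obtain ⟨n, -, hn⟩ := hfreq 0
  obtain ⟨k, hk, hk'⟩ := hfreq (n + 1)
  exact hVC (mk_mem_prod hn hk') (hpair n k hk)

end Big

/-! ### The index set ω₁ and the passage from compact sets to functions -/

theorem countable_Iic_omegaOne (α : OmegaOne) : (Iic α).Countable := by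
  have hlt : ∀ a : Ordinal.{0}, a < Ordinal.omega 1 → (Iic a).Countable := by
    intro a h
    rw [← Cardinal.ord_aleph, Cardinal.lt_ord, ← Cardinal.succ_aleph0,
      Order.lt_succ_iff] at h
    rw [← Iio_insert]
    refine Set.Countable.insert _ ?_
    rwa [← Cardinal.le_aleph0_iff_set_countable, Cardinal.mk_Iio_ordinal,
      Cardinal.lift_le_aleph0]
  exact ((hlt α α.2).preimage Subtype.val_injective).mono fun β hβ => hβ

theorem mk_omegaOne : Cardinal.mk OmegaOne = Cardinal.aleph 1 := by
  rw [Cardinal.mk_Iio_ordinal, Ordinal.card_omega, Cardinal.lift_aleph]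
  simp

instance : Uncountable OmegaOne := by
  rw [← Cardinal.aleph0_lt_mk_iff, mk_omegaOne]
  exact Cardinal.aleph0_lt_aleph_one

theorem exists_injective_omegaOne : ∃ r : OmegaOne → ℕ → Bool, Function.Injective r := by
  have h : Cardinal.lift.{0} (Cardinal.mk OmegaOne) ≤ Cardinal.lift.{1} (Cardinal.mk (ℕ → Bool)) := by
    rw [mk_omegaOne]
    simpa using Cardinal.aleph_one_le_continuum
  obtain ⟨r⟩ := Cardinal.lift_mk_le'.1 h
  exact ⟨r, r.injective⟩

theorem isCompact_Iic_nat (f : ℕ → ℕ) : IsCompact (Iic f) := by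
  rw [← pi_univ_Iic]
  exact isCompact_univ_pi fun n => (finite_Iic (f n)).isCompact

theorem HasPDiagonal.exists_monotone_cover {X : Type*} [TopologicalSpace X] [T2Space X]
    (h : HasPDiagonal X) :
    ∃ C : (ℕ → ℕ) → Set (X × X), (∀ g, IsCompact (C g)) ∧ Monotone C ∧ (∀ g x, (x, x) ∉ C g) ∧
      ∀ x y, x ≠ y → ∃ g, (x, y) ∈ C g := by
  obtain ⟨C, hC, hcov, hmono⟩ := h
  refine ⟨fun g => Subtype.val '' C ⟨Iic g, isCompact_Iic_nat g⟩,
    fun g => (hC _).image continuous_subtype_val,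
    fun f g hfg => image_mono (hmono _ _ (Iic_subset_Iic.2 hfg)), ?_, fun x y hxy => ?_⟩
  · rintro g x ⟨p, -, hp⟩
    exact p.2 (by rw [hp]; exact rfl)
  · have hmem : (⟨(x, y), hxy⟩ : {p : X × X // p ∉ diagonal X}) ∈ ⋃ K, C K := by
      rw [hcov]; trivial
    obtain ⟨K, hK⟩ := mem_iUnion.1 hmem
    have hb : ∀ n, ∃ m, ∀ f ∈ (K : Set SpaceP), f n ≤ m := by
      intro n
      obtain ⟨m, hm⟩ := ((K.isCompact.image (continuous_apply n)).finite_of_discrete).bddAbove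
      exact ⟨m, fun f hf => hm (mem_image_of_mem _ hf)⟩
    choose g hg using hb
    exact ⟨g, _, hmono K ⟨Iic g, isCompact_Iic_nat g⟩ (fun f hf n => hg n f hf) hK, rfl⟩

/-- Closed subspaces are allowed because the second claim uses the preimage of {0,1}^{ω₁}. -/
theorem HasPDiagonal.not_exists_surjective_of_isClosed {X : Type*} [TopologicalSpace X]
    [CompactSpace X] [T2Space X] (h : HasPDiagonal X) {Y : Set X} (hY : IsClosed Y)
    {φ : Y → CantorCube} (hφ : Continuous φ) (hsurj : Function.Surjective φ) : False := by
  obtain ⟨C, hC, hmono, hdiag, hcov⟩ := h.exists_monotone_cover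
  obtain ⟨r, hr⟩ := exists_injective_omegaOne
  have : CompactSpace Y := isCompact_iff_compactSpace.1 hY.isCompact
  let i : Y × Y → X × X := Prod.map Subtype.val Subtype.val
  have hi : Continuous i := continuous_subtype_val.prodMap continuous_subtype_val
  exact false_of_monotone_closed_cover_compl_diagonal countable_Iic_omegaOne hr hφ hsurj
    (C := fun g => i ⁻¹' C g) (fun g => (hC g).isClosed.preimage hi)
    (fun f g hfg => preimage_mono (hmono hfg)) (fun g x => hdiag g x)
    fun x y hxy => hcov x y (Subtype.coe_ne_coe.2 hxy)

theorem mainTheorem2 {X : Type*} [TopologicalSpace X] [CompactSpace X] [T2Space X] :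
    ((∃ φ : X → CantorCube, Continuous φ ∧ Function.Surjective φ) → ¬ HasPDiagonal X) ∧
    (HasPDiagonal X → ¬ ∃ φ : X → TychonoffCube, Continuous φ ∧ Function.Surjective φ) := by
  refine ⟨fun ⟨φ, hφ, hsurj⟩ h => ?_, fun h ⟨φ, hφ, hsurj⟩ => ?_⟩
  · refine h.not_exists_surjective_of_isClosed isClosed_univ
      (φ := fun x => φ x) (hφ.comp continuous_subtype_val) fun y => ?_
    obtain ⟨x, rfl⟩ := hsurj y
    exact ⟨⟨x, trivial⟩, rfl⟩
  · let j : Bool → I := fun b => if b then 1 else 0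
    have hj : Topology.IsClosedEmbedding j := by
      refine Topology.IsClosedEmbedding.of_continuous_injective_isClosedMap
        continuous_of_discreteTopology (fun a b hab => ?_) (fun s _ => (s.toFinite.image j).isClosed)
      cases a <;> cases b <;> simp_all [j]
    let J : CantorCube → TychonoffCube := fun y ξ => j (y ξ)
    have hJc : Continuous J := continuous_pi fun ξ => hj.continuous.comp (continuous_apply ξ)
    have hJ : Topology.IsClosedEmbedding J :=
      hJc.isClosedEmbedding fun y y' h => funext fun ξ => hj.injective (congrFun h ξ)
    let e := hJ.isEmbedding.toHomeomorph
    refine h.not_exists_surjective_of_isClosed (hJ.isClosed_range.preimage hφ)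
      (φ := fun x => e.symm ⟨φ x, x.2⟩)
      (e.symm.continuous.comp ((hφ.comp continuous_subtype_val).subtype_mk _)) fun y => ?_
    obtain ⟨x, hx⟩ := hsurj (J y)
    refine ⟨⟨x, y, hx.symm⟩, ?_⟩
    rw [Homeomorph.symm_apply_eq]
    exact Subtype.ext hx
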